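/- Let $\Gamma$ be a finitely generated residually finite group which is an extension $1\to H\to\Gamma\to G\to 1$ of a group $H$ by a group $G$; regard $H$ as a normal subgroup of $\Gamma$ and identify $G=\Gamma/H$. Let $K_1\supseteq K_2\supseteq\cdots$ be a nested sequence of finite index normal subgroups of $\Gamma$ with $\bigcap_i K_i=\{1\}$. Fix a finite generating set of $\Gamma$ and let $\Box_{\{K_i\}}\Gamma$ be the corresponding box space: the disjoint union $\bigsqcup_i \Gamma/K_i$, where each $\Gamma/K_i$ carries the metric $d_i$ of its Cayley graph with respect to the image of the generating set, where the distances $d(e_i,e_{i+1})$ between the identity elements of successive quotients are chosen greater than the maximum of their diameters, and where for $\alpha\in\Gamma/K_i$, $\beta\in\Gamma/K_j$ with $i<j$, $$d(\alpha,\beta)=d_i(\alpha,e_i)+\sum_{k=i}^{j-1}d(e_k,e_{k+1})+d_j(e_j,\beta).$$ Let $\Box_{\{H\cap K_i\}}H=\bigsqcup_i H/(H\cap K_i)\cong\bigsqcup_i HK_i/K_i\subseteq\Box_{\{K_i\}}\Gamma$ be equipped with the induced subspace metric, and suppose that it embeds coarsely into a Hilbert space, i.e. there are a map $F$ from it to a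 Hilbert space and non-decreasing functions $\rho_\pm:\mathbb{R}_+\to\mathbb{R}_+$ with $\lim_{t\to\infty}\rho_\pm(t)=\infty$ such that $\rho_-(d(x,x'))\le\|F(x)-F(x')\|\le\rho_+(d(x,x'))$ for all $x,x'$. Let $L=\bigcap_i HK_i/H$, a normal subgroup of $G$. If $G/L$ is amenable, then $\Gamma$ has the Haagerup property, i.e. $\Gamma$ (as a discrete group) admits an isometric, metrically proper action on some affine Hilbert space. -/

import Mathlib

open scoped NNReal Pointwise symmDiff

/-- A metric space `X` is coarsely embeddable in a metric space `Y`. -/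
def CoarselyEmbeddable (X Y : Type*) [MetricSpace X] [MetricSpace Y] : Prop :=
  ∃ (F : X → Y) (ρ₁ ρ₂ : ℝ≥0 → ℝ≥0), Monotone ρ₁ ∧ Monotone ρ₂ ∧
    Filter.Tendsto ρ₁ Filter.atTop Filter.atTop ∧ Filter.Tendsto ρ₂ Filter.atTop Filter.atTop ∧
    ∀ x x' : X, ρ₁ (nndist x x') ≤ nndist (F x) (F x') ∧
      nndist (F x) (F x') ≤ ρ₂ (nndist x x')

/-- Amenability of a discrete group, in the form of Følner's condition. -/
def IsAmenableGroup (G : Type*) [Group G] : Prop :=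
  ∀ (F : Finset G) (ε : ℝ), 0 < ε → ∃ A : Set G, A.Finite ∧ A.Nonempty ∧
    ∀ g ∈ F, (((g • A) ∆ A).ncard : ℝ) ≤ ε * (A.ncard : ℝ)

/-- The Haagerup property of a discrete group: there is an isometric, metrically proper action on
some (real) affine Hilbert space. For a discrete group continuity of the action is automatic, and
metric properness says that for every bounded set `B` only finitely many `g` satisfy
`g B ∩ B ≠ ∅`. -/
def HasHaagerupProperty.{u} (G : Type u) [Group G] : Prop :=
  ∃ (V : Type u) (_ : NormedAddCommGroup V) (_ : InnerProductSpace ℝ V) (_ : CompleteSpace V)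
    (α : G →* (V ≃ᵃⁱ[ℝ] V)),
    ∀ B : Set V, Bornology.IsBounded B → {g : G | ((α g '' B) ∩ B).Nonempty}.Finite

section Box

variable {Γ : Type*} [Group Γ]

/-- The Cayley graph of `Γ ⧸ N` with respect to the image of a subset `S` of `Γ`. -/
def quotientCayley (S : Set Γ) (N : Subgroup Γ) [N.Normal] : SimpleGraph (Γ ⧸ N) :=
  SimpleGraph.mulCayley ((fun g : Γ => (g : Γ ⧸ N)) '' S)

/-- The choices needed to metrize the box space of `Γ` with respect to a sequence `K` of normal
subgroups: a finite generating set of `Γ`, and for each `i` a distance `gap i` between the identity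
elements of `Γ ⧸ K i` and `Γ ⧸ K (i + 1)` that exceeds the diameters of both quotients. -/
structure BoxDatum (K : ℕ → Subgroup Γ) [∀ i, (K i).Normal] where
  gens : Finset Γ
  closure_gens : Subgroup.closure (gens : Set Γ) = ⊤
  gap : ℕ → ℝ
  lt_gap_left : ∀ (i : ℕ) (x y : Γ ⧸ K i),
    ((quotientCayley (gens : Set Γ) (K i)).dist x y : ℝ) < gap i
  lt_gap_right : ∀ (i : ℕ) (x y : Γ ⧸ K (i + 1)),
    ((quotientCayley (gens : Set Γ) (K (i + 1))).dist x y : ℝ) < gap i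

variable {K : ℕ → Subgroup Γ} [∀ i, (K i).Normal]

/-- The box space of `Γ`: the disjoint union of the quotients `Γ ⧸ K i`. -/
def BoxSpace (_D : BoxDatum K) : Type _ := Σ i : ℕ, Γ ⧸ K i

namespace BoxSpace

/-- The distance between the identity elements of the `i`-th and `j`-th components. -/
def threadDist (D : BoxDatum K) (i j : ℕ) : ℝ :=
  ∑ k ∈ Finset.Ico (min i j) (max i j), D.gap k

open Classical in
/-- The box metric: the graph metric of the Cayley graph on each component, and
`d(x, e_i) + d(e_i, e_j) + d(e_j, y)` for `x`, `y` in different components. -/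
noncomputable def boxDist (D : BoxDatum K) (x y : Σ i : ℕ, Γ ⧸ K i) : ℝ :=
  if h : x.1 = y.1 then
    ((quotientCayley (D.gens : Set Γ) (K y.1)).dist (h ▸ x.2) y.2 : ℝ)
  else
    ((quotientCayley (D.gens : Set Γ) (K x.1)).dist x.2 1 : ℝ) + threadDist D x.1 y.1 +
      ((quotientCayley (D.gens : Set Γ) (K y.1)).dist 1 y.2 : ℝ)

lemma boxDist_same (D : BoxDatum K) (i : ℕ) (x y : Γ ⧸ K i) :
    boxDist D ⟨i, x⟩ ⟨i, y⟩ = ((quotientCayley (D.gens : Set Γ) (K i)).dist x y : ℝ) := by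
  simp [boxDist]

lemma boxDist_ne (D : BoxDatum K) {i j : ℕ} (h : i ≠ j) (x : Γ ⧸ K i) (y : Γ ⧸ K j) :
    boxDist D ⟨i, x⟩ ⟨j, y⟩ = ((quotientCayley (D.gens : Set Γ) (K i)).dist x 1 : ℝ) +
      threadDist D i j + ((quotientCayley (D.gens : Set Γ) (K j)).dist 1 y : ℝ) := by
  simp [boxDist, h]

lemma quotientCayley_connected (S : Set Γ) (hS : Subgroup.closure S = ⊤) (N : Subgroup Γ)
    [N.Normal] : (quotientCayley S N).Connected := by
  have step : ∀ (g : Γ), g ∈ S → ∀ x : Γ ⧸ N, (quotientCayley S N).Reachable x (x * g) := by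
    intro g hg x
    by_cases h : x = x * (g : Γ ⧸ N)
    · rw [← h]
    · refine SimpleGraph.Adj.reachable ?_
      rw [quotientCayley, SimpleGraph.mulCayley_adj]
      exact ⟨h, Or.inl ⟨g, hg, by simp⟩⟩
  have key : ∀ g : Γ, ∀ x : Γ ⧸ N, (quotientCayley S N).Reachable x (x * g) := by
    intro g
    have hg : g ∈ Subgroup.closure S := by rw [hS]; trivial
    induction hg using Subgroup.closure_induction with
    | mem g hg => exact step g hg
    | one => intro x; simp
    | mul a b _ _ ha hb =>
      intro x
      have h := (ha x).trans (hb (x * (a : Γ ⧸ N)))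
      simpa [mul_assoc] using h
    | inv a _ ha =>
      intro x
      have h := (ha (x * (a⁻¹ : Γ))).symm
      simpa [mul_assoc] using h
  refine (SimpleGraph.connected_iff _).2 ⟨fun x y => ?_, ⟨1⟩⟩
  obtain ⟨g, hg⟩ := QuotientGroup.mk_surjective (x⁻¹ * y)
  have h := key g x
  rw [hg] at h
  simpa using h

lemma gap_pos (D : BoxDatum K) (i : ℕ) : 0 < D.gap i := by
  simpa using D.lt_gap_left i 1 1

lemma threadDist_eq (D : BoxDatum K) (i j : ℕ) :
    threadDist D i j = |∑ k ∈ Finset.range j, D.gap k - ∑ k ∈ Finset.range i, D.gap k| := by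
  have aux : ∀ a b : ℕ, a ≤ b → ∑ k ∈ Finset.Ico a b, D.gap k =
      |∑ k ∈ Finset.range b, D.gap k - ∑ k ∈ Finset.range a, D.gap k| := by
    intro a b hab
    rw [← Finset.sum_Ico_eq_sub _ hab, abs_of_nonneg]
    exact Finset.sum_nonneg fun k _ => (gap_pos D k).le
  rcases le_total i j with h | h
  · simp only [threadDist, min_eq_left h, max_eq_right h]
    exact aux i j h
  · simp only [threadDist, min_eq_right h, max_eq_left h]
    rw [abs_sub_comm]
    exact aux j i h

lemma threadDist_comm (D : BoxDatum K) (i j : ℕ) : threadDist D i j = threadDist D j i := by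
  simp only [threadDist, min_comm, max_comm]

lemma threadDist_nonneg (D : BoxDatum K) (i j : ℕ) : 0 ≤ threadDist D i j := by
  rw [threadDist_eq]; exact abs_nonneg _

lemma threadDist_pos (D : BoxDatum K) {i j : ℕ} (h : i ≠ j) : 0 < threadDist D i j := by
  refine Finset.sum_pos (fun k _ => gap_pos D k) ?_
  rw [Finset.nonempty_Ico]
  omega

lemma threadDist_triangle (D : BoxDatum K) (i j k : ℕ) :
    threadDist D i k ≤ threadDist D i j + threadDist D j k := by
  simp only [threadDist_eq]
  rw [add_comm]
  exact abs_sub_le _ _ _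

lemma boxDist_triangle (D : BoxDatum K) (x y z : Σ i : ℕ, Γ ⧸ K i) :
    boxDist D x z ≤ boxDist D x y + boxDist D y z := by
  obtain ⟨i, x⟩ := x
  obtain ⟨j, y⟩ := y
  obtain ⟨k, z⟩ := z
  have tri : ∀ (l : ℕ) (a b c : Γ ⧸ K l),
      ((quotientCayley (D.gens : Set Γ) (K l)).dist a c : ℝ) ≤
        ((quotientCayley (D.gens : Set Γ) (K l)).dist a b : ℝ) +
        ((quotientCayley (D.gens : Set Γ) (K l)).dist b c : ℝ) := by
    intro l a b c
    exact_mod_cast (quotientCayley_connected (D.gens : Set Γ) D.closure_gens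
      (K l)).dist_triangle
  have nn : ∀ (l : ℕ) (a b : Γ ⧸ K l),
      (0 : ℝ) ≤ ((quotientCayley (D.gens : Set Γ) (K l)).dist a b : ℝ) :=
    fun l a b => Nat.cast_nonneg _
  by_cases hij : i = j
  · subst hij
    by_cases hik : i = k
    · subst hik
      simp only [boxDist_same]
      exact tri _ _ _ _
    · simp only [boxDist_same, boxDist_ne D hik]
      linarith [tri i x y 1]
  · by_cases hjk : j = k
    · subst hjk
      simp only [boxDist_same, boxDist_ne D hij]
      linarith [tri j 1 y z]
    · by_cases hik : i = k
      · subst hik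
        simp only [boxDist_same, boxDist_ne D hij, boxDist_ne D hjk]
        linarith [tri i x 1 z, nn j 1 y, nn j y 1, threadDist_nonneg D i j,
          threadDist_nonneg D j i]
      · simp only [boxDist_ne D hij, boxDist_ne D hjk, boxDist_ne D hik]
        linarith [nn j 1 y, nn j y 1, threadDist_triangle D i j k]

noncomputable instance instMetricSpace (D : BoxDatum K) : MetricSpace (BoxSpace D) where
  dist x y := boxDist D x y
  dist_self := by
    rintro ⟨i, x⟩
    change boxDist D ⟨i, x⟩ ⟨i, x⟩ = 0
    simp [boxDist_same]
  dist_comm := by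
    rintro ⟨i, x⟩ ⟨j, y⟩
    change boxDist D ⟨i, x⟩ ⟨j, y⟩ = boxDist D ⟨j, y⟩ ⟨i, x⟩
    by_cases h : i = j
    · subst h
      simp only [boxDist_same]
      rw [SimpleGraph.dist_comm]
    · rw [boxDist_ne D h, boxDist_ne D (Ne.symm h), threadDist_comm D i j,
        SimpleGraph.dist_comm (u := x), SimpleGraph.dist_comm (v := y)]
      ring
  dist_triangle x y z := boxDist_triangle D x y z
  eq_of_dist_eq_zero := by
    rintro ⟨i, x⟩ ⟨j, y⟩ h
    change boxDist D ⟨i, x⟩ ⟨j, y⟩ = 0 at h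
    by_cases hij : i = j
    · subst hij
      rw [boxDist_same, Nat.cast_eq_zero,
        (quotientCayley_connected (D.gens : Set Γ) D.closure_gens (K i)).dist_eq_zero_iff] at h
      rw [h]
    · rw [boxDist_ne D hij] at h
      have h1 := threadDist_pos D hij
      have h2 : (0 : ℝ) ≤ ((quotientCayley (D.gens : Set Γ) (K i)).dist x 1 : ℝ) :=
        Nat.cast_nonneg _
      have h3 : (0 : ℝ) ≤ ((quotientCayley (D.gens : Set Γ) (K j)).dist 1 y : ℝ) :=
        Nat.cast_nonneg _
      linarith

end BoxSpace

/-- For a homomorphism `f : H →* Γ` (in practice the inclusion of a subgroup), the disjoint union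
of the quotients `H ⧸ f⁻¹(K i)`, which are the quotients `H ⧸ (H ∩ K i)` when `f` is an
inclusion. -/
def SubBoxSpace {H : Type*} [Group H] (_D : BoxDatum K) (f : H →* Γ) : Type _ :=
  Σ i : ℕ, H ⧸ (K i).comap f

namespace SubBoxSpace

variable {H : Type*} [Group H]

/-- The natural injection of the disjoint union of the `H ⧸ (H ∩ K i)` into the box space
of `Γ`. -/
def toBox (D : BoxDatum K) (f : H →* Γ) (x : SubBoxSpace D f) : BoxSpace D :=
  ⟨x.1, QuotientGroup.map ((K x.1).comap f) (K x.1) f le_rfl x.2⟩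

lemma toBox_injective (D : BoxDatum K) (f : H →* Γ) : Function.Injective (toBox D f) := by
  rintro ⟨i, x⟩ ⟨j, y⟩ h
  have hij : i = j := congrArg Sigma.fst h
  subst hij
  have h' : QuotientGroup.map ((K i).comap f) (K i) f le_rfl x =
      QuotientGroup.map ((K i).comap f) (K i) f le_rfl y := by
    simpa using eq_of_heq (Sigma.mk.inj h).2
  obtain ⟨a, rfl⟩ := QuotientGroup.mk_surjective x
  obtain ⟨b, rfl⟩ := QuotientGroup.mk_surjective y
  have hab : a⁻¹ * b ∈ (K i).comap f := by
    simpa [QuotientGroup.eq] using h'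
  rw [QuotientGroup.eq.2 hab]

/-- The subspace metric induced from the box space of `Γ`. -/
noncomputable instance instMetricSpace (D : BoxDatum K) (f : H →* Γ) :
    MetricSpace (SubBoxSpace D f) :=
  MetricSpace.induced (toBox D f) (toBox_injective D f) inferInstance

end SubBoxSpace

/-- For an extension `1 → H → Γ → G → 1`, the subgroup `L` of `G` that is the intersection of
the subgroups `H K_i / H` of `G = Γ / H`. -/
def extensionCore {H G : Type*} [Group H] [Group G] (E : GroupExtension H Γ G)
    (K : ℕ → Subgroup Γ) : Subgroup G :=
  ⨅ i, (E.inl.range ⊔ K i).map E.rightHom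

instance extensionCore_normal {H G : Type*} [Group H] [Group G] (E : GroupExtension H Γ G) :
    (extensionCore E K).Normal := by
  unfold extensionCore
  refine Subgroup.normal_iInf_normal fun i => ?_
  have h : (E.inl.range ⊔ K i).Normal := by
    rw [E.range_inl_eq_ker_rightHom]
    infer_instance
  exact h.map E.rightHom E.rightHom_surjective

end Box

/-! Let M be the kernel of Γ → G/L, that is, the intersection of the subgroups HK_i. Every m in M
maps into the finite group P_i = HK_i/K_i, on which the coarse embedding F is defined. Averaging
exp(-t‖F(y) - F(ym)‖²) over y in P_i gives a normalized positive definite function of m. The control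
functions of F do not depend on i, so this function is close to 1 on a prescribed ball for small t,
and is small at m once the image of m is far from 1 in Γ/K_i. As the K_i shrink to 1, the distance
in Γ/K_i eventually exceeds any radius below the word length of m in Γ, so an ultralimit over i is a
C₀ positive definite function on M (`hasC0Approximation_of_coarselyEmbeddable`).

Følner sets of G/L then induce these functions from M to Γ
(`HasC0Approximation.of_amenable_quotient`). Finally, summing deviations 1 - φ_n yields a proper
conditionally negative definite function, and a GNS construction turns it into a proper affine
isometric action (`HasC0Approximation.hasHaagerupProperty`). -/

/-! ### Positive semidefinite kernels and Schoenberg's Gaussian kernel -/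

section Kernels

variable {X Y : Type*}

/-- The bilinear form on finitely supported functions associated with a kernel. -/
noncomputable def kernelForm (k : Matrix X X ℝ) : (X →₀ ℝ) →ₗ[ℝ] (X →₀ ℝ) →ₗ[ℝ] ℝ :=
  Finsupp.linearCombination ℝ fun x => Finsupp.linearCombination ℝ (k x)

lemma kernelForm_apply (k : Matrix X X ℝ) (a b : X →₀ ℝ) :
    kernelForm k a b = a.sum fun x c => b.sum fun y d => c * k x y * d := by
  simp only [kernelForm, Finsupp.linearCombination_apply, Finsupp.sum, LinearMap.sum_apply,
    LinearMap.smul_apply, smul_eq_mul, Finset.mul_sum]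
  exact Finset.sum_congr rfl fun x _ => Finset.sum_congr rfl fun y _ => by ring

@[simp]
lemma kernelForm_single (k : Matrix X X ℝ) (x y : X) (c d : ℝ) :
    kernelForm k (Finsupp.single x c) (Finsupp.single y d) = c * k x y * d := by
  simp [kernelForm_apply]

lemma posSemidef_iff_kernelForm (k : Matrix X X ℝ) :
    k.PosSemidef ↔ (∀ x y, k x y = k y x) ∧ ∀ a, 0 ≤ kernelForm k a a := by
  simp only [Matrix.PosSemidef, kernelForm_apply, star_trivial]
  refine and_congr_left fun _ => ⟨fun h x y => ?_, fun h => ?_⟩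
  · simpa using h.apply y x
  · exact Matrix.IsHermitian.ext fun x y => by simpa using h y x

lemma kernelForm_comm {k : Matrix X X ℝ} (h : ∀ x y, k x y = k y x) (a b : X →₀ ℝ) :
    kernelForm k a b = kernelForm k b a := by
  rw [kernelForm_apply, kernelForm_apply, Finsupp.sum_comm]
  refine Finsupp.sum_congr fun x _ => Finsupp.sum_congr fun y _ => ?_
  rw [h]
  ring

/-- Pulling a kernel back along a map into the finitely supported functions. -/
lemma kernelForm_linearCombination {k : Matrix X X ℝ} {l : Matrix Y Y ℝ} (v : Y → X →₀ ℝ)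
    (h : ∀ x y, l x y = kernelForm k (v x) (v y)) (a b : Y →₀ ℝ) :
    kernelForm l a b = kernelForm k (Finsupp.linearCombination ℝ v a)
      (Finsupp.linearCombination ℝ v b) := by
  have : kernelForm l = (kernelForm k).compl₁₂ (Finsupp.linearCombination ℝ v)
      (Finsupp.linearCombination ℝ v) := by
    ext x y
    simp [h]
  rw [this]
  rfl

lemma Matrix.PosSemidef.of_kernelForm {k : Matrix X X ℝ} (hk : k.PosSemidef) {l : Matrix Y Y ℝ}
    (v : Y → X →₀ ℝ) (h : ∀ x y, l x y = kernelForm k (v x) (v y)) : l.PosSemidef := by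
  rw [posSemidef_iff_kernelForm] at hk ⊢
  refine ⟨fun x y => ?_, fun a => ?_⟩
  · rw [h, h, kernelForm_comm hk.1]
  · rw [kernelForm_linearCombination v h]
    exact hk.2 _

/-- Each test vector is finitely supported and sees only finitely many entries, so pointwise limits
suffice. This covers power series, infinite sums and ultralimits alike. -/
lemma Matrix.PosSemidef.of_tendsto {ι : Type*} {f : Filter ι} [f.NeBot]
    {k : ι → Matrix X X ℝ} {l : Matrix X X ℝ} (hk : ∀ i, (k i).PosSemidef)
    (h : ∀ x y, Filter.Tendsto (fun i => k i x y) f (nhds (l x y))) : l.PosSemidef := by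
  simp only [posSemidef_iff_kernelForm] at hk ⊢
  refine ⟨fun x y => ?_, fun a => ?_⟩
  · refine tendsto_nhds_unique (h x y) ?_
    simpa only [(hk _).1 x y] using h y x
  · refine ge_of_tendsto' (f := fun i => kernelForm (k i) a a) (x := f) ?_ fun i => (hk i).2 a
    simp only [kernelForm_apply, Finsupp.sum]
    exact tendsto_finsetSum _ fun x _ => tendsto_finsetSum _ fun y _ =>
      ((h x y).const_mul _).mul_const _

variable {V : Type*} [NormedAddCommGroup V] [InnerProductSpace ℝ V]

lemma posSemidef_inner (v : X → V) :
    (Matrix.of fun x y => inner ℝ (v x) (v y)).PosSemidef := by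
  rw [posSemidef_iff_kernelForm]
  refine ⟨fun x y => real_inner_comm _ _, fun a => ?_⟩
  have : kernelForm (Matrix.of fun x y => inner ℝ (v x) (v y)) a a =
      inner ℝ (a.sum fun x c => c • v x) (a.sum fun x c => c • v x) := by
    rw [kernelForm_apply, Finsupp.sum_inner]
    refine Finsupp.sum_congr fun x _ => ?_
    simp only [real_inner_smul_left, inner_sum, real_inner_smul_right, Finsupp.sum,
      Matrix.of_apply, mul_comm, mul_left_comm]
  rw [this]
  exact real_inner_self_nonneg

lemma posSemidef_mul (u : X → ℝ) : (Matrix.of fun x y => u x * u y).PosSemidef := by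
  convert posSemidef_inner u using 4
  simp [mul_comm]

lemma Matrix.PosSemidef.real_mul {k l : Matrix X X ℝ} (hk : k.PosSemidef) (hl : l.PosSemidef) :
    (Matrix.of fun x y => k x y * l x y).PosSemidef :=
  hk.hadamard hl

lemma posSemidef_inner_pow (v : X → V) (n : ℕ) :
    (Matrix.of fun x y => inner ℝ (v x) (v y) ^ n).PosSemidef := by
  induction n with
  | zero => simpa using posSemidef_mul fun _ : X => (1 : ℝ)
  | succ n ih =>
    simpa [pow_succ] using ih.real_mul (posSemidef_inner v)

/-- The exponential series has nonnegative coefficients, and powers of a Gram kernel are positive by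
Schur's product theorem. -/
lemma posSemidef_exp_inner (v : X → V) {t : ℝ} (ht : 0 ≤ t) :
    (Matrix.of fun x y => Real.exp (t * inner ℝ (v x) (v y))).PosSemidef := by
  refine Matrix.PosSemidef.of_tendsto (f := Filter.atTop)
    (k := fun n => ∑ j ∈ Finset.range n, (t ^ j / j.factorial) •
      Matrix.of fun x y => inner ℝ (v x) (v y) ^ j) (fun n => ?_) fun x y => ?_
  · exact Matrix.posSemidef_sum _ fun j _ => (posSemidef_inner_pow v j).smul (by positivity)
  · have h := (NormedSpace.expSeries_div_hasSum_exp (t * inner ℝ (v x) (v y))).tendsto_sum_nat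
    rw [← Real.exp_eq_exp_ℝ] at h
    simpa [Matrix.sum_apply, mul_pow, div_mul_eq_mul_div] using h

/-- The Gaussian kernel on a Hilbert space is positive semidefinite. -/
lemma posSemidef_gaussian (v : X → V) {t : ℝ} (ht : 0 ≤ t) :
    (Matrix.of fun x y => Real.exp (-(t * ‖v x - v y‖ ^ 2))).PosSemidef := by
  -- Expanding the square factors the Gaussian as a rank-one kernel times exp(2t⟨v x, v y⟩).
  have h := (posSemidef_mul fun x => Real.exp (-(t * ‖v x‖ ^ 2))).real_mul
    (posSemidef_exp_inner v (t := 2 * t) (by positivity))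
  simp only [Matrix.of_apply, ← Real.exp_add] at h
  convert h using 4 with x y
  rw [norm_sub_sq_real]
  ring_nf

end Kernels

/-! ### Positive definite functions on a group -/

section PositiveDefinite

variable {G : Type*} [Group G]

/-- Positive definite real functions on a group. -/
def IsPositiveDefinite (φ : G → ℝ) : Prop :=
  (Matrix.of fun x y : G => φ (x⁻¹ * y)).PosSemidef

/-- The identity is approximated pointwise by normalized positive definite functions
vanishing at infinity. -/
def HasC0Approximation (G : Type*) [Group G] : Prop :=
  ∀ (F : Finset G) (ε : ℝ), 0 < ε → ∃ φ : G → ℝ, IsPositiveDefinite φ ∧ φ 1 = 1 ∧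
    (∀ δ : ℝ, 0 < δ → {g | δ ≤ |φ g|}.Finite) ∧ ∀ g ∈ F, 1 - ε ≤ φ g

lemma IsPositiveDefinite.inv {φ : G → ℝ} (h : IsPositiveDefinite φ) (g : G) :
    φ g⁻¹ = φ g := by
  simpa using ((posSemidef_iff_kernelForm _).1 h).1 g 1

lemma IsPositiveDefinite.le_one {φ : G → ℝ} (h : IsPositiveDefinite φ) (h1 : φ 1 = 1) (g : G) :
    φ g ≤ 1 := by
  have := ((posSemidef_iff_kernelForm _).1 h).2 (Finsupp.single g 1 - Finsupp.single 1 1)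
  simp [h1, h.inv] at this
  linarith

end PositiveDefinite

/-! ### From C₀ positive definite functions to a proper affine action -/

section AffineAction

universe u

variable {G : Type u} [Group G]

/-- An isometric action on a semi-inner product space, strict up to points at distance zero,
induces an affine isometric action on the completion. -/
lemma hasHaagerupProperty_of_isometries {E : Type u} [SeminormedAddCommGroup E]
    [InnerProductSpace ℝ E] (A : G → E → E) (hA : ∀ g, Isometry (A g))
    (hmul : ∀ g h, A (g * h) = A g ∘ A h) (hone : ∀ x, dist (A 1 x) x = 0)
    (hproper : ∀ R : ℝ, {g | dist (A g 0) 0 ≤ R}.Finite) : HasHaagerupProperty G := by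
  let B : G → UniformSpace.Completion E → UniformSpace.Completion E :=
    fun g => UniformSpace.Completion.map (A g)
  have hB : ∀ g, Isometry (B g) := fun g => (hA g).completion_map
  have hBmul : ∀ g h, B (g * h) = B g ∘ B h := fun g h => by
    simp only [B]
    rw [UniformSpace.Completion.map_comp (hA g).uniformContinuous (hA h).uniformContinuous, hmul]
  have hBcoe : ∀ g (x : E), B g x = (A g x : E) := fun g x =>
    UniformSpace.Completion.map_coe (hA g).uniformContinuous x
  have hBone : B 1 = id := by
    refine UniformSpace.Completion.ext (hB 1).continuous continuous_id fun x => ?_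
    refine eq_of_dist_eq_zero ?_
    rw [hBcoe, id, UniformSpace.Completion.dist_eq, hone]
  let e : G → UniformSpace.Completion E ≃ᵢ UniformSpace.Completion E := fun g =>
    { toFun := B g
      invFun := B g⁻¹
      left_inv := fun x => by
        rw [← Function.comp_apply (f := B g⁻¹), ← hBmul, inv_mul_cancel, hBone, id]
      right_inv := fun x => by
        rw [← Function.comp_apply (f := B g), ← hBmul, mul_inv_cancel, hBone, id]
      isometry_toFun := hB g }
  -- By the Mazur–Ulam theorem a bijective isometry of a real normed space is affine, so no
  -- linearity of `A g` is needed.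
  have he : ∀ g x, (e g).toRealAffineIsometryEquiv x = B g x := fun g x => rfl
  refine ⟨UniformSpace.Completion E, inferInstance, inferInstance, inferInstance,
    { toFun := fun g => (e g).toRealAffineIsometryEquiv
      map_one' := by
        ext x
        rw [he, hBone]
        rfl
      map_mul' := fun g h => by
        ext x
        rw [he, hBmul]
        rfl }, fun S hS => ?_⟩
  obtain ⟨R, hR⟩ := hS.subset_closedBall 0
  -- If x and gx both lie in the ball of radius R, then ‖g0‖ ≤ ‖g0 - gx‖ + ‖gx‖ ≤ 2R.
  refine (hproper (R + R)).subset ?_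
  rintro g ⟨y, ⟨x, hx, rfl⟩, hy⟩
  have hx' : dist x ((0 : E) : UniformSpace.Completion E) ≤ R := hR hx
  have hy' : dist (B g x) ((0 : E) : UniformSpace.Completion E) ≤ R := hR hy
  change dist (A g 0) 0 ≤ R + R
  rw [← UniformSpace.Completion.dist_eq, ← hBcoe]
  refine (dist_triangle _ (B g x) _).trans (add_le_add ?_ hy')
  rwa [(hB g).dist_eq, dist_comm]

/-- The semi-inner product on finitely supported functions given by a positive semidefinite
kernel. -/
noncomputable abbrev kernelCore {X : Type*} {k : Matrix X X ℝ} (hk : k.PosSemidef) :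
    PreInnerProductSpace.Core ℝ (X →₀ ℝ) where
  inner a b := kernelForm k a b
  conj_inner_symm a b := kernelForm_comm ((posSemidef_iff_kernelForm k).1 hk).1 b a
  re_inner_nonneg a := ((posSemidef_iff_kernelForm k).1 hk).2 a
  add_left a b c := by simp
  smul_left a b r := by simp

/-- A proper conditionally negative definite function yields the Haagerup property. -/
lemma hasHaagerupProperty_of_conditionallyNegative (ψ : G → ℝ) (hone : ψ 1 = 0)
    (hk : (Matrix.of fun s t : G => ψ s + ψ t - ψ (s⁻¹ * t)).PosSemidef)
    (hproper : ∀ C : ℝ, {g | ψ g ≤ C}.Finite) : HasHaagerupProperty G := by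
  set k : Matrix G G ℝ := Matrix.of fun s t : G => ψ s + ψ t - ψ (s⁻¹ * t) with hkdef
  have kapp : ∀ s t, k s t = ψ s + ψ t - ψ (s⁻¹ * t) := fun s t => rfl
  have hinv : ∀ g, ψ g⁻¹ = ψ g := fun g => by
    have := ((posSemidef_iff_kernelForm k).1 hk).1 g 1
    simp only [kapp, inv_one, one_mul, mul_one] at this
    linarith
  let _ : SeminormedAddCommGroup (G →₀ ℝ) :=
    InnerProductSpace.Core.toSeminormedAddCommGroup (c := kernelCore hk)
  let _ : InnerProductSpace ℝ (G →₀ ℝ) := InnerProductSpace.ofCore (kernelCore hk)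
  have hnorm : ∀ a : G →₀ ℝ, ‖a‖ ^ 2 = kernelForm k a a := fun a =>
    (real_inner_self_eq_norm_sq a).symm
  -- The basis vector at s plays the role of b(s) for a cocycle b; the identity b(gs) = b(g) + T_g
  -- b(s) dictates this formula.
  let v : G → G → G →₀ ℝ := fun g s => Finsupp.single (g * s) 1 - Finsupp.single g 1
  let T : G → (G →₀ ℝ) →ₗ[ℝ] (G →₀ ℝ) := fun g => Finsupp.linearCombination ℝ (v g)
  have hT : ∀ g a, ‖T g a‖ = ‖a‖ := fun g a => by
    rw [← sq_eq_sq₀ (norm_nonneg _) (norm_nonneg _), hnorm, hnorm]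
    refine (kernelForm_linearCombination (v g) (fun s t => ?_) a a).symm
    simp only [v, map_sub, LinearMap.sub_apply, kernelForm_single, kapp, mul_inv_rev, mul_assoc,
      inv_mul_cancel_left, inv_mul_cancel, hone, mul_one, one_mul, hinv]
    ring
  have hTT : ∀ g h, T (g * h) = T g ∘ₗ T h := fun g h => by
    ext s : 2
    simp [T, v, mul_assoc]
  refine hasHaagerupProperty_of_isometries (fun g a => T g a + Finsupp.single g 1)
    (fun g => Isometry.of_dist_eq fun a b => ?_) (fun g h => ?_) (fun a => ?_) fun R => ?_
  · rw [dist_add_right, dist_eq_norm, dist_eq_norm, ← map_sub, hT]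
  · funext a
    simp [hTT, add_assoc, T, v]
  -- The map `T 1` moves a vector only by a multiple of the basis vector at 1, which is null because
  -- k(1,1) = ψ(1) = 0.
  · have h1 : ∀ c : ℝ, ‖(Finsupp.single (1 : G) c : G →₀ ℝ)‖ = 0 := fun c => by
      rw [← sq_eq_zero_iff, hnorm]
      simp [kapp, hone]
    have h2 : T 1 a - a = Finsupp.single 1 (-(a.sum fun _ c => c)) := by
      induction a using Finsupp.induction_linear with
      | zero => simp
      | add a b ha hb =>
        rw [map_add, add_sub_add_comm, ha, hb, ← Finsupp.single_add,
          Finsupp.sum_add_index' (fun _ => rfl) fun _ _ _ => rfl, neg_add]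
      | single s c => simp [T, v, smul_sub]
    rw [dist_eq_norm, add_sub_right_comm, h2, ← Finsupp.single_add, h1]
  · refine (hproper (R ^ 2)).subset fun g hg => ?_
    simp only [Set.mem_ofPred_eq, map_zero, zero_add, dist_zero_right] at hg
    have h := pow_le_pow_left₀ (norm_nonneg _) hg 2
    rw [hnorm] at h
    -- The squared norm is 2ψ(g); its nonnegativity gives ψ(g) ≤ 2ψ(g) ≤ R².
    have hnn := sq_nonneg ‖(Finsupp.single g 1 : G →₀ ℝ)‖
    rw [hnorm] at hnn
    simp only [kernelForm_single, kapp, inv_mul_cancel, hone] at h hnn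
    change ψ g ≤ R ^ 2
    linarith

/-- Summing the deviations from `1` of a sequence of `C₀` positive definite functions gives a
proper conditionally negative definite function. -/
lemma HasC0Approximation.hasHaagerupProperty [Countable G] (h : HasC0Approximation G) :
    HasHaagerupProperty G := by
  obtain ⟨f, hf⟩ := exists_injective_nat G
  have hfin : ∀ n : ℕ, {g : G | f g ≤ n}.Finite := fun n =>
    (Set.finite_Iic n).preimage hf.injOn
  -- Each g lies in all but finitely many of the test sets, so 1 - φ_n(g) is eventually dominated by
  -- a geometric series.
  choose φ hpd hone hC0 happ using fun n : ℕ =>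
    h (hfin n).toFinset ((1 / 2) ^ n) (by positivity)
  have hle : ∀ n g, φ n g ≤ 1 := fun n g => (hpd n).le_one (hone n) g
  have hsum : ∀ g, Summable fun n => 1 - φ n g := fun g => by
    refine Summable.of_norm_bounded_eventually_nat summable_geometric_two ?_
    filter_upwards [Filter.eventually_ge_atTop (f g)] with n hn
    rw [Real.norm_of_nonneg (sub_nonneg.2 (hle n g))]
    have := happ n g (by simpa using hn)
    linarith
  let ψ : G → ℝ := fun g => ∑' n, (1 - φ n g)
  refine hasHaagerupProperty_of_conditionallyNegative ψ (by simp [ψ, hone]) ?_ fun C => ?_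
  · let l : ℕ → Matrix G G ℝ := fun n =>
      Matrix.of fun s t => (1 - φ n s) + (1 - φ n t) - (1 - φ n (s⁻¹ * t))
    have hl : ∀ n, (l n).PosSemidef := fun n => by
      -- Evaluating the form of φ_n on δ_s - δ_1 and δ_t - δ_1 produces exactly the kernel of 1 -
      -- φ_n.
      refine (hpd n).of_kernelForm (fun s => Finsupp.single s 1 - Finsupp.single 1 1)
        fun s t => ?_
      simp [l, hone, (hpd n).inv]
      ring
    refine Matrix.PosSemidef.of_tendsto (f := Filter.atTop)
      (k := fun N => ∑ n ∈ Finset.range N, l n)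
      (fun N => Matrix.posSemidef_sum _ fun n _ => hl n) fun s t => ?_
    have := (((hsum s).hasSum.add (hsum t).hasSum).sub (hsum (s⁻¹ * t)).hasSum).tendsto_sum_nat
    simpa [Matrix.sum_apply, l] using this
  -- Outside the first N sets {|φ_n| ≥ 1/2}, each of N terms exceeds 1/2, forcing ψ(g) ≥ N/2 > C.
  · obtain ⟨N, hN⟩ := exists_nat_gt (2 * C)
    refine (Set.Finite.biUnion (Finset.range N).finite_toSet
      fun n _ => hC0 n (1 / 2) (by norm_num)).subset fun g hg => ?_
    by_contra hcon
    simp only [Set.mem_iUnion, not_exists, Set.mem_ofPred_eq, not_le, Finset.mem_coe] at hcon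
    have h1 : ∑ n ∈ Finset.range N, (1 / 2 : ℝ) ≤ ψ g := by
      refine (Finset.sum_le_sum fun n hn => ?_).trans
        ((hsum g).sum_le_tsum _ fun n _ => sub_nonneg.2 (hle n g))
      have := (abs_lt.1 (hcon n hn)).2
      linarith
    have h2 : ψ g ≤ C := hg
    simp at h1
    linarith

end AffineAction

/-! ### Induction through an amenable quotient -/

section AmenableQuotient

variable {G Q : Type*} [Group G] [Group Q]

/-- The cocycle `G × Q → ker π` attached to a section `σ` of a surjection `π`. -/
def sectionCocycle (π : G →* Q) (σ : Q → G) (hσ : ∀ q, π (σ q) = q) (g : G) (q : Q) : π.ker :=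
  ⟨(σ q)⁻¹ * g * σ ((π g)⁻¹ * q), by simp [MonoidHom.mem_ker, hσ]⟩

/-- Shifting the base point by (π s)⁻¹ gives the form c_s⁻¹ c_t to which positive definiteness of φ
applies. -/
lemma sectionCocycle_inv_mul (π : G →* Q) (σ : Q → G) (hσ : ∀ q, π (σ q) = q) (s t : G) (q : Q) :
    sectionCocycle π σ hσ (s⁻¹ * t) ((π s)⁻¹ * q) =
      (sectionCocycle π σ hσ s q)⁻¹ * sectionCocycle π σ hσ t q := by
  ext
  simp [sectionCocycle, mul_assoc]

open Classical in
/-- The function on `G` induced from a function on the kernel of `π : G →* Q`, truncated to a finite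
subset of `Q`. -/
noncomputable def inducedFunction (π : G →* Q) (σ : Q → G) (hσ : ∀ q, π (σ q) = q) (A : Finset Q)
    (φ : π.ker → ℝ) (g : G) : ℝ :=
  (∑ q ∈ A, if (π g)⁻¹ * q ∈ A then φ (sectionCocycle π σ hσ g q) else 0) / A.card

variable {π : G →* Q} {σ : Q → G} {hσ : ∀ q, π (σ q) = q} {A : Finset Q} {φ : π.ker → ℝ}

/-- After the shift q ↦ (π s)⁻¹q, the value at s⁻¹t is a sum over q of rank-one cut-off kernels
times pullbacks of φ. The shifted range of summation depends on s, so the sum is taken over all of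
Q, as a limit over finite subsets. -/
lemma isPositiveDefinite_inducedFunction (hφ : IsPositiveDefinite φ) :
    IsPositiveDefinite (inducedFunction π σ hσ A φ) := by
  classical
  let u : Q → G → ℝ := fun q g => if (π g)⁻¹ * q ∈ A then 1 else 0
  let c := sectionCocycle π σ hσ
  let k : Q → Matrix G G ℝ := fun q => Matrix.of fun s t =>
    u q s * u q t * φ ((c s q)⁻¹ * c t q)
  have hk : ∀ q, (k q).PosSemidef := fun q =>
    (posSemidef_mul (u q)).real_mul (Matrix.PosSemidef.submatrix hφ fun s => c s q)
  have hsum : ∀ g, HasSum (fun q => u q 1 * u q g * φ (c g q))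
      (∑ q ∈ A, if (π g)⁻¹ * q ∈ A then φ (c g q) else 0) := fun g => by
    have h : ∑ q ∈ A, u q 1 * u q g * φ (c g q) =
        ∑ q ∈ A, if (π g)⁻¹ * q ∈ A then φ (c g q) else 0 :=
      Finset.sum_congr rfl fun q hq => by simp [u, hq]
    rw [← h]
    exact hasSum_sum_of_ne_finset_zero fun q hq => by simp [u, hq]
  refine Matrix.PosSemidef.of_tendsto (f := Filter.atTop)
    (k := fun P : Finset Q => (A.card : ℝ)⁻¹ • ∑ q ∈ P, k q)
    (fun P => (Matrix.posSemidef_sum _ fun q _ => hk q).smul (by positivity)) fun s t => ?_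
  have h := ((Equiv.mulLeft (π s)⁻¹).hasSum_iff.2 (hsum (s⁻¹ * t))).mul_left (A.card : ℝ)⁻¹
  rw [HasSum, SummationFilter.unconditional_filter] at h
  convert h using 2 with P
  · simp only [Matrix.smul_apply, Matrix.sum_apply, smul_eq_mul, Finset.mul_sum]
    refine Finset.sum_congr rfl fun q _ => ?_
    simp [k, u, c, sectionCocycle_inv_mul, mul_assoc]
  · simp [inducedFunction, c, div_eq_inv_mul]

lemma inducedFunction_one (hA : A.Nonempty) (h1 : φ 1 = 1) :
    inducedFunction π σ hσ A φ 1 = 1 := by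
  have h : ∀ q, sectionCocycle π σ hσ 1 q = 1 := fun q => by
    ext
    simp [sectionCocycle]
  have hc : (A.card : ℝ) ≠ 0 := by exact_mod_cast hA.card_ne_zero
  simp +contextual [inducedFunction, h, h1, hc]

/-- A large average has a large term, and g is recovered from that term's cocycle value together
with p and (π g)⁻¹p, which both lie in A. -/
lemma finite_le_abs_inducedFunction (hA : A.Nonempty) {δ : ℝ} (hδ : 0 < δ)
    (h : {m | δ ≤ |φ m|}.Finite) : {g | δ ≤ |inducedFunction π σ hσ A φ g|}.Finite := by
  classical
  refine (Set.Finite.biUnion A.finite_toSet fun p _ => Set.Finite.biUnion A.finite_toSet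
    fun q _ => h.image fun m : π.ker => σ p * m * (σ q)⁻¹).subset fun g hg => ?_
  by_contra hcon
  simp only [Set.mem_iUnion, Set.mem_image, not_exists, not_and, Finset.mem_coe] at hcon
  have hc : (0 : ℝ) < A.card := by exact_mod_cast hA.card_pos
  refine absurd (show δ ≤ |inducedFunction π σ hσ A φ g| from hg) (not_le.2 ?_)
  rw [inducedFunction, abs_div, Nat.abs_cast, div_lt_iff₀ hc]
  refine (Finset.abs_sum_le_sum_abs _ _).trans_lt ?_
  rw [mul_comm, ← nsmul_eq_mul, ← Finset.sum_const]
  refine Finset.sum_lt_sum_of_nonempty hA fun p hp => ?_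
  split_ifs with hq
  · by_contra hlt
    exact hcon p hp _ hq (sectionCocycle π σ hσ g p) (not_lt.1 hlt) (by
      simp [sectionCocycle, mul_assoc])
  · simpa using hδ

/-- One ε is lost to φ, the other to the points of A outside (π g)A, where the summand is 0. -/
lemma le_inducedFunction (hA : A.Nonempty) {ε : ℝ} (hε : 0 ≤ ε) (g : G)
    (h : ∀ q ∈ A, 1 - ε ≤ φ (sectionCocycle π σ hσ g q))
    (hF : (((π g • (A : Set Q)) ∆ (A : Set Q)).ncard : ℝ) ≤ ε * A.card) :
    1 - (ε + ε) ≤ inducedFunction π σ hσ A φ g := by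
  classical
  have hc : (0 : ℝ) < A.card := by exact_mod_cast hA.card_pos
  rw [inducedFunction, le_div_iff₀ hc]
  have h1 : ((A.filter fun q => (π g)⁻¹ * q ∉ A).card : ℝ) ≤ ε * A.card := by
    refine le_trans ?_ hF
    rw [← Set.ncard_coe_finset]
    refine Nat.cast_le.2 (Set.ncard_le_ncard (fun q hq => ?_) ?_)
    · simp only [Finset.coe_filter, Set.mem_ofPred_eq] at hq
      refine Or.inr ⟨hq.1, fun hq' => hq.2 ?_⟩
      simpa [Set.mem_smul_set_iff_inv_smul_mem] using hq'
    · exact (A.finite_toSet.smul_set.union A.finite_toSet).subset symmDiff_le_sup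
  have h2 : ∑ q ∈ A, (1 - ε - if (π g)⁻¹ * q ∈ A then (0 : ℝ) else 1) ≤
      ∑ q ∈ A, if (π g)⁻¹ * q ∈ A then φ (sectionCocycle π σ hσ g q) else 0 := by
    refine Finset.sum_le_sum fun q hq => ?_
    split_ifs
    · simpa using h q hq
    · linarith
  have h3 : ∑ q ∈ A, (if (π g)⁻¹ * q ∈ A then (0 : ℝ) else 1) =
      (A.filter fun q => (π g)⁻¹ * q ∉ A).card := by
    simp [Finset.sum_ite]
  rw [Finset.sum_sub_distrib, h3, Finset.sum_const, nsmul_eq_mul] at h2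
  linarith

/-- `C₀` approximations pass to extensions with amenable quotient. -/
lemma HasC0Approximation.of_amenable_quotient (hπ : Function.Surjective π)
    (hQ : IsAmenableGroup Q) (h : HasC0Approximation π.ker) : HasC0Approximation G := by
  classical
  intro F ε hε
  obtain ⟨σ, hσ⟩ := hπ.hasRightInverse
  obtain ⟨A', hfin, hne, hA⟩ := hQ (F.image π) (ε / 2) (by positivity)
  lift A' to Finset Q using hfin
  rename' A' => A
  -- The Følner set is fixed first, so that φ can be chosen close to 1 on the finitely many cocycle
  -- values it produces.
  obtain ⟨φ, hpd, h1, hC0, happ⟩ := h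
    ((F ×ˢ A).image fun x => sectionCocycle π σ hσ x.1 x.2) (ε / 2) (by positivity)
  refine ⟨inducedFunction π σ hσ A φ, isPositiveDefinite_inducedFunction hpd,
    inducedFunction_one hne h1, fun δ hδ => finite_le_abs_inducedFunction hne hδ (hC0 δ hδ),
    fun g hg => ?_⟩
  have := le_inducedFunction (hσ := hσ) hne (by positivity) g
    (fun q hq => happ _ (Finset.mem_image.2 ⟨(g, q), by simp [hg, hq], rfl⟩))
    (by simpa [Set.ncard_coe_finset] using hA (π g) (Finset.mem_image_of_mem _ hg))
  linarith

end AmenableQuotient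

/-! ### Averaged Gaussians on finite groups -/

section AveragedGaussian

variable {P V : Type*} [Group P] [Fintype P] [NormedAddCommGroup V]

/-- The average over a finite group of the Gaussian of the displacement of `f`. -/
noncomputable def averagedGaussian (f : P → V) (t : ℝ) (p : P) : ℝ :=
  (Fintype.card P : ℝ)⁻¹ * ∑ y, Real.exp (-(t * ‖f y - f (y * p)‖ ^ 2))

/-- Substituting y ↦ yp in the average at p⁻¹q turns each displacement into f(yp) - f(yq), leaving
an average of Gaussian kernels. -/
lemma isPositiveDefinite_averagedGaussian [InnerProductSpace ℝ V] (f : P → V) {t : ℝ}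
    (ht : 0 ≤ t) : IsPositiveDefinite (averagedGaussian f t) := by
  have h := (Matrix.posSemidef_sum Finset.univ fun y _ =>
    posSemidef_gaussian (fun p => f (y * p)) ht).smul
      (a := (Fintype.card P : ℝ)⁻¹) (by positivity)
  rw [IsPositiveDefinite]
  convert h using 1
  ext p q
  simp only [averagedGaussian, Matrix.of_apply, Matrix.smul_apply, Matrix.sum_apply, smul_eq_mul]
  rw [← Equiv.sum_comp (Equiv.mulRight p)]
  simp [mul_assoc]

lemma averagedGaussian_one (f : P → V) (t : ℝ) : averagedGaussian f t 1 = 1 := by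
  simp [averagedGaussian]

lemma averagedGaussian_nonneg (f : P → V) (t : ℝ) (p : P) : 0 ≤ averagedGaussian f t p := by
  unfold averagedGaussian
  positivity

lemma averagedGaussian_le (f : P → V) {t : ℝ} (ht : 0 ≤ t) {p : P} {c : ℝ} (hc : 0 ≤ c)
    (h : ∀ y, c ≤ ‖f y - f (y * p)‖) : averagedGaussian f t p ≤ Real.exp (-(t * c ^ 2)) := by
  rw [averagedGaussian, inv_mul_le_iff₀ (by exact_mod_cast Fintype.card_pos), ← nsmul_eq_mul]
  refine Finset.sum_le_card_nsmul _ _ _ fun y _ => ?_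
  gcongr
  exact h y

lemma le_averagedGaussian (f : P → V) {t : ℝ} (ht : 0 ≤ t) {p : P} {c : ℝ}
    (h : ∀ y, ‖f y - f (y * p)‖ ≤ c) : Real.exp (-(t * c ^ 2)) ≤ averagedGaussian f t p := by
  rw [averagedGaussian, le_inv_mul_iff₀ (by exact_mod_cast Fintype.card_pos), ← nsmul_eq_mul]
  refine Finset.card_nsmul_le_sum _ _ _ fun y _ => ?_
  gcongr
  exact h y

lemma averagedGaussian_mem_Icc (f : P → V) {t : ℝ} (ht : 0 ≤ t) (p : P) :
    averagedGaussian f t p ∈ Set.Icc (0 : ℝ) 1 :=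
  ⟨averagedGaussian_nonneg f t p, by
    simpa using averagedGaussian_le f ht le_rfl fun y => norm_nonneg (f y - f (y * p))⟩

end AveragedGaussian

/-! ### Word balls in Γ and distances in its quotients -/

section WordBall

variable {Γ : Type*} [Group Γ]

/-- The ball of radius `n` about the identity for the word length of `S`. -/
def wordBall (S : Set Γ) (n : ℕ) : Set Γ := (insert 1 (S ∪ S⁻¹)) ^ n

lemma wordBall_mono (S : Set Γ) : Monotone (wordBall S) := fun _ _ h =>
  Set.pow_subset_pow_right (Set.mem_insert 1 _) h

lemma finite_wordBall {S : Set Γ} (hS : S.Finite) (n : ℕ) : (wordBall S n).Finite := by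
  induction n with
  | zero => simp [wordBall]
  | succ n ih =>
    rw [wordBall, pow_succ]
    exact Set.Finite.mul ih ((hS.union hS.inv).insert 1)

lemma exists_mem_wordBall {S : Set Γ} (hS : Subgroup.closure S = ⊤) (g : Γ) :
    ∃ n, g ∈ wordBall S n := by
  have hg : g ∈ Subgroup.closure S := by simp [hS]
  induction hg using Subgroup.closure_induction with
  | mem g hg => exact ⟨1, by simp [wordBall, hg]⟩
  | one => exact ⟨0, by simp [wordBall]⟩
  | mul a b _ _ ha hb =>
    obtain ⟨m, hm⟩ := ha
    obtain ⟨n, hn⟩ := hb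
    exact ⟨m + n, by rw [wordBall, pow_add]; exact Set.mul_mem_mul hm hn⟩
  | inv a _ ha =>
    obtain ⟨n, hn⟩ := ha
    refine ⟨n, ?_⟩
    have hinv : (insert 1 (S ∪ S⁻¹))⁻¹ = insert 1 (S ∪ S⁻¹) := by
      rw [Set.inv_insert, Set.union_inv, inv_inv, inv_one, Set.union_comm]
    rw [wordBall, ← hinv, inv_pow, Set.inv_mem_inv]
    exact hn

lemma countable_of_closure_eq_top {S : Set Γ} (hfin : S.Finite) (hS : Subgroup.closure S = ⊤) :
    Countable Γ := by
  refine Set.countable_univ_iff.1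
    ((Set.countable_iUnion fun n => (finite_wordBall hfin n).countable).mono fun g _ => ?_)
  exact Set.mem_iUnion.2 (exists_mem_wordBall hS g)

variable {S : Set Γ} {N : Subgroup Γ} [N.Normal]

lemma quotientCayley_dist_mul_le (hS : Subgroup.closure S = ⊤) {n : ℕ} {g : Γ}
    (hg : g ∈ wordBall S n) (x : Γ ⧸ N) : (quotientCayley S N).dist x (x * g) ≤ n := by
  induction n generalizing g with
  | zero =>
    obtain rfl : g = 1 := by simpa [wordBall] using hg
    simp
  | succ n ih =>
    rw [wordBall, pow_succ] at hg
    obtain ⟨a, ha, s, hs, rfl⟩ := hg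
    refine (BoxSpace.quotientCayley_connected S hS N).dist_triangle.trans
      (add_le_add (ih ha) ?_)
    rw [QuotientGroup.mk_mul, ← mul_assoc]
    generalize x * (a : Γ ⧸ N) = y
    by_cases hy : y = y * (s : Γ ⧸ N)
    · simp [← hy]
    · refine (SimpleGraph.dist_eq_one_iff_adj.2 ?_).le
      rw [quotientCayley, SimpleGraph.mulCayley_adj']
      rcases hs with rfl | hs | hs
      · simp at hy
      · exact ⟨hy, _, ⟨s, hs, rfl⟩, Or.inl rfl⟩
      · exact ⟨hy, _, ⟨s⁻¹, hs, rfl⟩, Or.inr (by simp)⟩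

lemma exists_eq_mul_of_walk {x y : Γ ⧸ N} (p : (quotientCayley S N).Walk x y) :
    ∃ b ∈ wordBall S p.length, y = x * b := by
  induction p with
  | nil => exact ⟨1, by simp [wordBall], by simp⟩
  | cons h p ih =>
    obtain ⟨b, hb, rfl⟩ := ih
    rw [quotientCayley, SimpleGraph.mulCayley_adj'] at h
    obtain ⟨-, _, ⟨s, hs, rfl⟩, h⟩ := h
    rw [SimpleGraph.Walk.length_cons, wordBall, pow_succ']
    rcases h with h | h
    · exact ⟨s * b, Set.mul_mem_mul (by simp [hs]) hb, by simp [← h, mul_assoc]⟩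
    · exact ⟨s⁻¹ * b, Set.mul_mem_mul (by simp [hs]) hb, by simp [h, mul_assoc]⟩

lemma exists_eq_mul_of_dist_le (hS : Subgroup.closure S = ⊤) {n : ℕ} {x y : Γ ⧸ N}
    (h : (quotientCayley S N).dist x y ≤ n) : ∃ b ∈ wordBall S n, y = x * b := by
  obtain ⟨p, hp⟩ := (BoxSpace.quotientCayley_connected S hS N).exists_walk_length_eq_dist x y
  obtain ⟨b, hb, rfl⟩ := exists_eq_mul_of_walk p
  exact ⟨b, wordBall_mono S (hp.trans_le h) hb, rfl⟩

/-- For each b in B the nontrivial element b⁻¹g leaves some K_j, hence all later ones by nesting;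
finiteness of B makes this uniform. With B a word ball, g becomes far from 1 in Γ/K_i. -/
lemma eventually_mk_notMem_image {K : ℕ → Subgroup Γ} (hK : Antitone K) (hK1 : ⨅ i, K i = ⊥)
    {B : Set Γ} (hB : B.Finite) {g : Γ} (hg : g ∉ B) :
    ∀ᶠ i in Filter.atTop, ∀ b ∈ B, (g : Γ ⧸ K i) ≠ b := by
  refine (Filter.eventually_all_finite hB).2 fun b hb => ?_
  have hne : b⁻¹ * g ∉ ⨅ i, K i := by
    rw [hK1, Subgroup.mem_bot, inv_mul_eq_one]
    rintro rfl
    exact hg hb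
  simp only [Subgroup.mem_iInf, not_forall] at hne
  obtain ⟨j, hj⟩ := hne
  filter_upwards [Filter.eventually_ge_atTop j] with i hi h
  exact hj (hK hi (QuotientGroup.eq.1 h.symm))

end WordBall

/-! ### C₀ approximation from the box space, and the conclusion -/

section BoxApproximation

variable {Γ H : Type*} [Group Γ] [Group H] {K : ℕ → Subgroup Γ} [∀ i, (K i).Normal]

/-- The inclusion of the `i`-th component of the box space of `H`. -/
def SubBoxSpace.component (D : BoxDatum K) (f : H →* Γ) (i : ℕ) (x : H ⧸ (K i).comap f) :
    SubBoxSpace D f :=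
  ⟨i, x⟩

lemma SubBoxSpace.dist_component (D : BoxDatum K) (f : H →* Γ) (i : ℕ) (x y : H ⧸ (K i).comap f) :
    dist (component D f i x) (component D f i y) =
      (quotientCayley (D.gens : Set Γ) (K i)).dist
        (QuotientGroup.map ((K i).comap f) (K i) f le_rfl x)
        (QuotientGroup.map ((K i).comap f) (K i) f le_rfl y) :=
  BoxSpace.boxDist_same D i _ _

/-- A coarse embedding of the box space of `H` restricts to each of the image subgroups of
`H` in the quotients of `Γ`, with control independent of the quotient. -/
lemma exists_embedding_components {V : Type*} [NormedAddCommGroup V] (D : BoxDatum K) (f : H →* Γ)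
    (h : CoarselyEmbeddable (SubBoxSpace D f) V) :
    ∃ (F : ∀ i, f.range.map (QuotientGroup.mk' (K i)) → V) (ρ₁ ρ₂ : ℕ → ℝ),
      Filter.Tendsto ρ₁ Filter.atTop Filter.atTop ∧
      (∀ i n x y, n ≤ (quotientCayley (D.gens : Set Γ) (K i)).dist x.1 y.1 →
        ρ₁ n ≤ ‖F i x - F i y‖) ∧
      ∀ i n x y, (quotientCayley (D.gens : Set Γ) (K i)).dist x.1 y.1 ≤ n →
        ‖F i x - F i y‖ ≤ ρ₂ n := by
  obtain ⟨F, ρ₁, ρ₂, hm₁, hm₂, ht₁, -, hF⟩ := h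
  have hex : ∀ i (x : f.range.map (QuotientGroup.mk' (K i))), ∃ w : H ⧸ (K i).comap f,
      QuotientGroup.map ((K i).comap f) (K i) f le_rfl w = x := by
    rintro i ⟨_, _, ⟨a, rfl⟩, rfl⟩
    exact ⟨a, rfl⟩
  choose w hw using hex
  have hd : ∀ i x y, nndist (SubBoxSpace.component D f i (w i x)) (SubBoxSpace.component D f i (w i y)) =
      (quotientCayley (D.gens : Set Γ) (K i)).dist x.1 y.1 := fun i x y => by
    rw [← NNReal.coe_inj, coe_nndist, SubBoxSpace.dist_component, hw, hw, NNReal.coe_natCast]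
  refine ⟨fun i x => F (SubBoxSpace.component D f i (w i x)), fun n => ρ₁ n, fun n => ρ₂ n, ?_, fun i n x y h => ?_,
    fun i n x y h => ?_⟩
  · exact NNReal.tendsto_coe_atTop.2 (ht₁.comp tendsto_natCast_atTop_atTop)
  · rw [← dist_eq_norm, ← coe_nndist, NNReal.coe_le_coe]
    refine (hm₁ ?_).trans (hF _ _).1
    rw [hd]
    exact_mod_cast h
  · rw [← dist_eq_norm, ← coe_nndist, NNReal.coe_le_coe]
    refine (hF _ _).2.trans (hm₂ ?_)
    rw [hd]
    exact_mod_cast h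

/-- A subgroup of `Γ` whose images in the quotients `Γ ⧸ K i` lie in those of `H` has `C₀`
approximations as soon as the box space of `H` embeds coarsely into a Hilbert space. -/
lemma hasC0Approximation_of_coarselyEmbeddable [∀ i, (K i).FiniteIndex] (hK : Antitone K)
    (hK1 : ⨅ i, K i = ⊥) (D : BoxDatum K) (f : H →* Γ) {V : Type*} [NormedAddCommGroup V]
    [InnerProductSpace ℝ V] (h : CoarselyEmbeddable (SubBoxSpace D f) V) (M : Subgroup Γ)
    (hM : ∀ m ∈ M, ∀ i, (m : Γ ⧸ K i) ∈ f.range.map (QuotientGroup.mk' (K i))) :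
    HasC0Approximation M := by
  intro A ε hε
  obtain ⟨F, ρ₁, ρ₂, ht₁, h₁, h₂⟩ := exists_embedding_components D f h
  have hS := D.closure_gens
  have := fun i => Fintype.ofFinite (f.range.map (QuotientGroup.mk' (K i)))
  let q : ∀ i, M →* f.range.map (QuotientGroup.mk' (K i)) := fun i =>
    ((QuotientGroup.mk' (K i)).comp M.subtype).codRestrict _ fun m => hM m m.2 i
  have hq : ∀ i m, (q i m : Γ ⧸ K i) = ((m : Γ) : Γ ⧸ K i) := fun i m => rfl
  obtain ⟨n, hn⟩ : ∃ n, ∀ m ∈ A, (m : Γ) ∈ wordBall (D.gens : Set Γ) n := by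
    choose l hl using exists_mem_wordBall hS
    exact ⟨A.sup fun m => l m, fun m hm =>
      wordBall_mono _ (Finset.le_sup (f := fun m : M => l m) hm) (hl m)⟩
  -- Chosen so that exp(-tρ₂(n)²) ≥ 1 - tρ₂(n)² ≥ 1 - ε; the +1 keeps the denominator positive.
  let t := ε / (ρ₂ n ^ 2 + 1)
  have ht : 0 < t := by positivity
  have htε : t * ρ₂ n ^ 2 ≤ ε := by
    rw [div_mul_eq_mul_div, div_le_iff₀ (by positivity)]
    nlinarith
  let φ : ℕ → M → ℝ := fun i m => averagedGaussian (F i) t (q i m)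
  have hIcc : ∀ i m, φ i m ∈ Set.Icc (0 : ℝ) 1 := fun i m =>
    averagedGaussian_mem_Icc _ ht.le _
  -- Values in the compact interval [0,1] converge along an ultrafilter, for all m at once without
  -- passing to subsequences.
  have hlim : ∀ m, ∃ c, Filter.Tendsto (fun i => φ i m) (Filter.hyperfilter ℕ) (nhds c) := fun m =>
    let ⟨c, _, hc⟩ := isCompact_Icc.ultrafilter_le_nhds' ((Filter.hyperfilter ℕ).map fun i => φ i m)
      (Filter.mem_map.2 (Filter.univ_mem' fun i => hIcc i m))
    ⟨c, hc⟩
  choose φ' hφ' using hlim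
  refine ⟨φ', ?_, ?_, fun δ hδ => ?_, fun m hm => ?_⟩
  · exact Matrix.PosSemidef.of_tendsto (k := fun i => Matrix.of fun x y : M => φ i (x⁻¹ * y))
      (fun i => by
        simpa [φ, Matrix.submatrix, IsPositiveDefinite] using Matrix.PosSemidef.submatrix
          (isPositiveDefinite_averagedGaussian (F i) ht.le) (q i)) fun x y => hφ' _
  · refine tendsto_nhds_unique (hφ' 1) ?_
    simp [φ, averagedGaussian_one]
  · have hexp : Filter.Tendsto (fun n => Real.exp (-(t * ρ₁ n ^ 2))) Filter.atTop (nhds 0) :=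
      Real.tendsto_exp_neg_atTop_nhds_zero.comp
        (((Filter.tendsto_pow_atTop two_ne_zero).comp ht₁).const_mul_atTop ht)
    -- Beyond radius l the Gaussian bound drops below δ; ρ₁(l) ≥ 0 is needed to square the lower
    -- bound on displacements.
    obtain ⟨l, hl, hl0⟩ := ((hexp.eventually_lt_const hδ).and
      (ht₁.eventually_ge_atTop 0)).exists
    refine ((finite_wordBall D.gens.finite_toSet l).preimage
      (f := ((↑) : M → Γ)) Subtype.val_injective.injOn).subset fun m hm => ?_
    by_contra hml
    have hev := eventually_mk_notMem_image hK hK1 (finite_wordBall D.gens.finite_toSet l) hml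
    have hle : φ' m ≤ Real.exp (-(t * ρ₁ l ^ 2)) := by
      refine le_of_tendsto (hφ' m) (Nat.hyperfilter_le_atTop ?_)
      filter_upwards [hev] with i hi
      refine averagedGaussian_le _ ht.le hl0 fun y => h₁ i l _ _ ?_
      -- If y and ym were closer than l, then ym = yb with b in the ball, and cancelling y would put
      -- the image of m in the image of the ball.
      by_contra! hlt
      obtain ⟨b, hb, hyb⟩ := exists_eq_mul_of_dist_le hS hlt.le
      exact hi b hb (mul_left_cancel hyb)
    have h0 : 0 ≤ φ' m := ge_of_tendsto' (hφ' m) fun i => (hIcc i m).1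
    have hm' : δ ≤ |φ' m| := hm
    rw [abs_of_nonneg h0] at hm'
    linarith
  · refine ge_of_tendsto' (hφ' m) fun i => ?_
    refine le_trans ?_ (le_averagedGaussian (F i) ht.le fun y => h₂ i n _ _ ?_)
    · have := Real.add_one_le_exp (-(t * ρ₂ n ^ 2))
      linarith
    · exact quotientCayley_dist_mul_le hS (hn m hm) _

end BoxApproximation

theorem mainTheorem6 {H Γ G : Type*} [Group H] [Group Γ] [Group G]
    [Group.FG Γ] [Group.ResiduallyFinite Γ] (E : GroupExtension H Γ G)
    (K : ℕ → Subgroup Γ) [∀ i, (K i).Normal] [∀ i, (K i).FiniteIndex]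
    (hK_nested : Antitone K) (hK_trivial : ⨅ i, K i = ⊥)
    (D : BoxDatum K)
    {V : Type*} [NormedAddCommGroup V] [InnerProductSpace ℝ V] [CompleteSpace V]
    (h_embed : CoarselyEmbeddable (SubBoxSpace D E.inl) V)
    (h_amenable : IsAmenableGroup (G ⧸ extensionCore E K)) :
    HasHaagerupProperty Γ := by

  let π := (QuotientGroup.mk' (extensionCore E K)).comp E.rightHom
  have hπ : Function.Surjective π :=
    (QuotientGroup.mk'_surjective _).comp E.rightHom_surjective
  have : Countable Γ := countable_of_closure_eq_top D.gens.finite_toSet D.closure_gens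
  refine (HasC0Approximation.of_amenable_quotient hπ h_amenable
    (hasC0Approximation_of_coarselyEmbeddable hK_nested hK_trivial D E.inl h_embed π.ker
      fun m hm i => ?_)).hasHaagerupProperty
  have hm' : E.rightHom m ∈ extensionCore E K := by
    -- It remains to place m in HK_i: some x in HK_i has the same image in G, so x⁻¹m lies in H.
    -- Modulo K_i the subgroups HK_i and H have the same image.
    simpa [π, MonoidHom.mem_ker] using hm
  rw [extensionCore, Subgroup.mem_iInf] at hm'
  obtain ⟨x, hx, hxm⟩ := hm' i
  have hxm' : x⁻¹ * m ∈ E.inl.range := by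
    rw [E.range_inl_eq_ker_rightHom, MonoidHom.mem_ker, map_mul, map_inv, hxm, inv_mul_cancel]
  have hmem : m ∈ E.inl.range ⊔ K i := by
    simpa using mul_mem hx (Subgroup.mem_sup_left (T := K i) hxm')
  have : QuotientGroup.mk' (K i) m ∈ (E.inl.range ⊔ K i).map (QuotientGroup.mk' (K i)) :=
    Subgroup.mem_map_of_mem _ hmem
  rwa [Subgroup.map_sup, QuotientGroup.map_mk'_self, sup_bot_eq] at this
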